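/- For real numbers $a,b>0$ with $a\neq b$ and $p\in\mathbb R$, let $$A=\frac{a+b}{2},\qquad G=\sqrt{ab},\qquad P=\frac{a-b}{2\arcsin\left(\frac{a-b}{a+b}\right)},\qquad X=A\,e^{G/P-1},$$ $$L=\frac{a-b}{\log a-\log b},\qquad I=\frac1e\left(\frac{a^a}{b^b}\right)^{1/(a-b)},\qquad M_p=\begin{cases}\left(\frac{a^p+b^p}{2}\right)^{1/p}, & p\neq 0,\\ \sqrt{ab}, & p=0.\end{cases}$$ Let $q=\dfrac{\log 2}{1+\log 2}$. Then, for all $a,b>0$ with $a\neq b$, $$\frac{A+G}{e}<X<M_q<\frac{L+I}{2}<\frac{A+G}{2}.$$ Moreover, the constant $q$ is best possible in both inequalities in which it occurs: $q$ is the least real number $p$ such that $X<M_p$ for all $a,b>0$ with $a\neq b$, and $q$ is the greatest real number $p$ such that $M_p<(L+I)/2$ for all $a,b>0$ with $a\neq b$. -/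

import Mathlib

noncomputable section

namespace BivariateMean

/-- The arithmetic mean `A(a, b) = (a + b) / 2`. -/
def A (a b : ℝ) : ℝ := (a + b) / 2

/-- The geometric mean `G(a, b) = √(a b)`. -/
def G (a b : ℝ) : ℝ := Real.sqrt (a * b)

/-- The Seiffert mean `P(a, b)` of two distinct positive reals. -/
def P (a b : ℝ) : ℝ := (a - b) / (2 * Real.arcsin ((a - b) / (a + b)))

/-- The mean `X = A e ^ (G / P - 1)` of two distinct positive reals. -/
def X (a b : ℝ) : ℝ := A a b * Real.exp (G a b / P a b - 1)

/-- The logarithmic mean `L(a, b)` of two distinct positive reals. -/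
def L (a b : ℝ) : ℝ := (a - b) / (Real.log a - Real.log b)

/-- The identric mean `I(a, b)` of two distinct positive reals. -/
def I (a b : ℝ) : ℝ := 1 / Real.exp 1 * (a ^ a / b ^ b) ^ (1 / (a - b))

/-- The power mean `M_p(a, b)` of order `p`, with `M_0 = √(a b)`. -/
def M (p a b : ℝ) : ℝ :=
  if p = 0 then Real.sqrt (a * b) else ((a ^ p + b ^ p) / 2) ^ (1 / p)

/-- The constant `q = log 2 / (1 + log 2)`. -/
def q : ℝ := Real.log 2 / (1 + Real.log 2)

end BivariateMean

end

section

open Real Set Filter Topology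

/-! All the means are symmetric and homogeneous, so write a = m e^t, b = m e^(-t) with t > 0 and
divide by m. Then A, G, X, L, I, M_p become cosh t, 1, cosh t · exp(arctan(sinh t)/sinh t - 1), sinh
t / t, exp(t coth t - 1) and cosh(pt)^(1/p) for p ≠ 0, and each link is an inequality in one
variable.

As t → ∞, X and (L + I)/2 are both asymptotic to e^(t-1)/2, while M_p ~ e^t 2^(-1/p) for p > 0. The
exponent with 2^(-1/p) = 1/(2e) is q, which gives its optimality on both sides.

For the inequalities the main tool is `CrossesDown`: the property passes from a derivative, up to a
positive factor, to a function with nonnegative limit at 0+. If such a function also tends to 0 at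
infinity, it is positive; this yields X < M_q. For M_q < (L + I)/2 the line is cut at t = 7/4:
before it, cosh x ≤ e^(x²/2) and AM-GM suffice; after it, the leading terms of M_q and I/2 agree and
L absorbs the error. The last link reduces to a power series with nonnegative coefficients. -/

/-- Once `k` is nonpositive at a positive point, it is negative at all later points. -/
def CrossesDown (k : ℝ → ℝ) : Prop := ∀ x, 0 < x → k x ≤ 0 → ∀ y, x < y → k y < 0

/-! ### Single sign changes and antiderivatives -/

theorem pos_of_hasDerivAt_pos {g g' : ℝ → ℝ} {l x : ℝ} (hx : 0 < x) (hl : 0 ≤ l)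
    (hlim : Tendsto g (𝓝[>] 0) (𝓝 l)) (hd : ∀ y, 0 < y → HasDerivAt g (g' y) y)
    (hpos : ∀ y, 0 < y → y < x → 0 < g' y) : 0 < g x := by
  have hmono : StrictMonoOn g (Ioc 0 x) := by
    apply strictMonoOn_of_deriv_pos (convex_Ioc 0 x)
    · intro y hy
      exact (hd y hy.1).continuousAt.continuousWithinAt
    · intro y hy
      rw [interior_Ioc] at hy
      rw [(hd y hy.1).deriv]
      exact hpos y hy.1 hy.2
  have hhalf : l ≤ g (x / 2) := by
    apply le_of_tendsto hlim
    filter_upwards [Ioo_mem_nhdsGT (show (0 : ℝ) < x / 2 by linarith)] with y hy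
    exact (hmono ⟨hy.1, by linarith [hy.2]⟩ ⟨by linarith, by linarith⟩ hy.2).le
  have := hmono (a := x / 2) (b := x) ⟨by linarith, by linarith⟩ ⟨hx, le_rfl⟩ (by linarith)
  linarith

/-- If `k` were positive on all of (0, x), `g` would increase from `l ≥ 0` and be positive at `x`.
So `k` is already nonpositive somewhere before `x`, hence negative from there on. -/
theorem CrossesDown.strictAntiOn_antideriv {g k p : ℝ → ℝ} {l : ℝ} (hk : CrossesDown k)
    (hp : ∀ x, 0 < x → 0 < p x) (hl : 0 ≤ l) (hlim : Tendsto g (𝓝[>] 0) (𝓝 l))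
    (hd : ∀ x, 0 < x → HasDerivAt g (p x * k x) x) {x : ℝ} (hx : 0 < x) (hgx : g x ≤ 0) :
    StrictAntiOn g (Ici x) := by
  obtain ⟨c, hc0, hcx, hkc⟩ : ∃ c, 0 < c ∧ c < x ∧ k c ≤ 0 := by
    by_contra! hcon
    have := pos_of_hasDerivAt_pos hx hl hlim hd
      (fun y hy hyx => mul_pos (hp y hy) (hcon y hy hyx))
    linarith
  apply strictAntiOn_of_deriv_neg (convex_Ici x)
  · intro y hy
    exact (hd y (hx.trans_le hy)).continuousAt.continuousWithinAt
  · intro y hy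
    rw [interior_Ici] at hy
    have hy0 : 0 < y := hx.trans hy
    rw [(hd y hy0).deriv]
    exact mul_neg_of_pos_of_neg (hp y hy0) (hk c hc0 hkc y (hcx.trans hy))

theorem CrossesDown.antideriv {g k p : ℝ → ℝ} {l : ℝ} (hk : CrossesDown k)
    (hp : ∀ x, 0 < x → 0 < p x) (hl : 0 ≤ l) (hlim : Tendsto g (𝓝[>] 0) (𝓝 l))
    (hd : ∀ x, 0 < x → HasDerivAt g (p x * k x) x) : CrossesDown g := by
  intro x hx hgx y hxy
  have := hk.strictAntiOn_antideriv hp hl hlim hd hx hgx self_mem_Ici hxy.le hxy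
  linarith

/-- A nonpositive value would force `g` to decrease strictly from then on, away from its limit 0. -/
theorem CrossesDown.pos_of_tendsto_zero {g k p : ℝ → ℝ} {l : ℝ} (hk : CrossesDown k)
    (hp : ∀ x, 0 < x → 0 < p x) (hl : 0 ≤ l) (hlim : Tendsto g (𝓝[>] 0) (𝓝 l))
    (hd : ∀ x, 0 < x → HasDerivAt g (p x * k x) x) (htop : Tendsto g atTop (𝓝 0))
    {x : ℝ} (hx : 0 < x) : 0 < g x := by
  by_contra! hgx
  have hanti := hk.strictAntiOn_antideriv hp hl hlim hd hx hgx
  have h1 : g (x + 1) < g x := hanti self_mem_Ici (by simp) (by linarith)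
  have h2 : (0 : ℝ) ≤ g (x + 1) := by
    apply le_of_tendsto htop
    filter_upwards [eventually_ge_atTop (x + 1)] with y hy
    exact hanti.antitoneOn (by simp) (mem_Ici.2 (by linarith)) hy
  linarith

theorem CrossesDown.of_strictAntiOn {k : ℝ → ℝ} (hk : StrictAntiOn k (Ioi 0)) :
    CrossesDown k := by
  intro x hx hkx y hxy
  exact (hk hx (hx.trans hxy) hxy).trans_le hkx

theorem CrossesDown.mul_pos {k p : ℝ → ℝ} (hk : CrossesDown k) (hp : ∀ x, 0 < x → 0 < p x) :
    CrossesDown (fun x => p x * k x) := by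
  intro x hx hkx y hxy
  exact mul_neg_of_pos_of_neg (hp y (hx.trans hxy))
    (hk x hx (nonpos_of_mul_nonpos_right hkx (hp x hx)) y hxy)

theorem pos_of_strictAntiOn_of_tendsto_zero {g : ℝ → ℝ} (hg : StrictAntiOn g (Ioi 0))
    (htop : Tendsto g atTop (𝓝 0)) {x : ℝ} (hx : 0 < x) : 0 < g x := by
  have h1 : g (x + 1) < g x := hg hx (mem_Ioi.2 (by linarith)) (by linarith)
  have h2 : (0 : ℝ) ≤ g (x + 1) := by
    apply le_of_tendsto htop
    filter_upwards [eventually_ge_atTop (x + 1)] with y hy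
    exact hg.antitoneOn (mem_Ioi.2 (by linarith)) (mem_Ioi.2 (by linarith)) hy
  linarith

/-! ### Limits at 0+ and at infinity -/

theorem tendsto_nhdsGT_of_continuous {g : ℝ → ℝ} (hg : Continuous g) :
    Tendsto g (𝓝[>] 0) (𝓝 (g 0)) :=
  (hg.tendsto 0).mono_left nhdsWithin_le_nhds

theorem tendsto_sinh_div_self : Tendsto (fun t : ℝ => sinh t / t) (𝓝[>] 0) (𝓝 1) := by
  have h := (hasDerivAt_sinh 0).tendsto_slope_zero_right
  simpa [div_eq_inv_mul] using h

theorem tendsto_mul_cosh_div_sinh :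
    Tendsto (fun t : ℝ => t * cosh t / sinh t) (𝓝[>] 0) (𝓝 1) := by
  have h1 := tendsto_sinh_div_self.inv₀ one_ne_zero
  have h2 := (tendsto_nhdsGT_of_continuous continuous_cosh).mul h1
  simp only [cosh_zero, inv_one, mul_one] at h2
  refine h2.congr fun t => ?_
  rw [inv_div]; ring

theorem tendsto_arctan_sinh_div_sinh :
    Tendsto (fun t : ℝ => arctan (sinh t) / sinh t) (𝓝[>] 0) (𝓝 1) := by
  have h : HasDerivAt (fun t : ℝ => arctan (sinh t)) 1 0 := by
    have := (hasDerivAt_sinh 0).arctan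
    simpa using this
  have h1 := h.tendsto_slope_zero_right
  have h2 := h1.mul (tendsto_sinh_div_self.inv₀ one_ne_zero)
  simp only [inv_one, mul_one] at h2
  refine h2.congr' ?_
  filter_upwards [self_mem_nhdsWithin] with t ht
  have ht' : t ≠ 0 := ne_of_gt ht
  simp
  field_simp

theorem tendsto_sinh_atTop : Tendsto sinh atTop atTop := by
  apply tendsto_atTop_mono' atTop _ tendsto_id
  filter_upwards [eventually_ge_atTop 0] with t ht
  exact self_le_sinh_iff.2 ht

theorem tendsto_cosh_atTop : Tendsto cosh atTop atTop :=
  tendsto_atTop_mono (fun t => (sinh_lt_cosh t).le) tendsto_sinh_atTop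

theorem tendsto_arctan_sinh_div_sinh_atTop :
    Tendsto (fun t : ℝ => arctan (sinh t) / sinh t) atTop (𝓝 0) :=
  ((tendsto_arctan_atTop.mono_right nhdsWithin_le_nhds).comp tendsto_sinh_atTop).div_atTop
    tendsto_sinh_atTop

theorem log_cosh_sub_self (t : ℝ) : log (cosh t) - t = log ((1 + exp (-(2 * t))) / 2) := by
  have h : (1 + exp (-(2 * t))) / 2 = cosh t * exp (-t) := by
    rw [cosh_eq, show -(2 * t) = -t + -t by ring, exp_add]
    have : exp t * exp (-t) = 1 := by rw [← exp_add]; simp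
    linear_combination (-1 / 2 : ℝ) * this
  rw [h, log_mul (cosh_pos t).ne' (exp_pos _).ne', log_exp]
  ring

theorem tendsto_exp_neg_two_mul : Tendsto (fun t : ℝ => exp (-(2 * t))) atTop (𝓝 0) :=
  tendsto_exp_neg_atTop_nhds_zero.comp (tendsto_id.const_mul_atTop two_pos)

theorem tendsto_log_cosh_sub_self :
    Tendsto (fun t : ℝ => log (cosh t) - t) atTop (𝓝 (-log 2)) := by
  have h2 : Tendsto (fun t : ℝ => (1 + exp (-(2 * t))) / 2) atTop (𝓝 ((1 + 0) / 2)) :=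
    (tendsto_exp_neg_two_mul.const_add 1).div_const 2
  have h3 := h2.log (by norm_num)
  rw [add_zero, one_div, log_inv] at h3
  exact h3.congr fun t => (log_cosh_sub_self t).symm

theorem tendsto_log_cosh_mul_sub_self {p : ℝ} (hp : 0 < p) :
    Tendsto (fun t : ℝ => 1 / p * log (cosh (p * t)) - t) atTop (𝓝 (-(log 2 / p))) := by
  have h := (tendsto_log_cosh_sub_self.comp (tendsto_id.const_mul_atTop hp)).const_mul (1 / p)
  rw [show -(log 2 / p) = 1 / p * -log 2 by ring]
  refine h.congr fun t => ?_
  simp only [Function.comp_apply, id]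
  field_simp

/-! ### The inequality (A + G)/e < X in hyperbolic form -/

theorem tanh_lt_arctan_sinh {t : ℝ} (ht : 0 < t) : tanh t < arctan (sinh t) := by
  have h : sin (arctan (sinh t)) = tanh t := by
    rw [sin_arctan, tanh_eq_sinh_div_cosh, add_comm, ← cosh_sq, sqrt_sq (cosh_pos t).le]
  rw [← h]
  exact sin_lt (arctan_pos.2 (sinh_pos_iff.2 ht))

theorem hasDerivAt_arctan_sinh (t : ℝ) :
    HasDerivAt (fun t : ℝ => arctan (sinh t)) (1 / cosh t) t := by
  have h := (hasDerivAt_sinh t).arctan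
  refine HasDerivAt.congr_deriv h ?_
  have := (cosh_pos t).ne'
  rw [add_comm, ← cosh_sq]
  field_simp

theorem hasDerivAt_arctan_sinh_div_sinh {t : ℝ} (ht : 0 < t) :
    HasDerivAt (fun t : ℝ => arctan (sinh t) / sinh t)
      (1 / (cosh t * sinh t) - arctan (sinh t) * cosh t / sinh t ^ 2) t := by
  have hs := (sinh_pos_iff.2 ht).ne'
  have hc := (cosh_pos t).ne'
  refine HasDerivAt.congr_deriv ((hasDerivAt_arctan_sinh t).div (hasDerivAt_sinh t) hs) ?_
  field_simp

theorem hasDerivAt_log_cosh (t : ℝ) : HasDerivAt (fun t : ℝ => log (cosh t)) (tanh t) t := by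
  rw [tanh_eq_sinh_div_cosh]
  exact (hasDerivAt_cosh t).log (cosh_pos t).ne'

/-- The difference of the two sides tends to 0 at infinity, and its derivative is a positive
multiple of tanh t - arctan(sinh t) < 0. -/
theorem log_one_add_inv_cosh_lt {t : ℝ} (ht : 0 < t) :
    log (1 + 1 / cosh t) < arctan (sinh t) / sinh t := by
  have hpos : ∀ x : ℝ, 0 < 1 + 1 / cosh x := fun x => by have := cosh_pos x; positivity
  have hd : ∀ x : ℝ, 0 < x →
      HasDerivAt (fun t => arctan (sinh t) / sinh t - log (1 + 1 / cosh t))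
        ((tanh x - arctan (sinh x)) * (cosh x / sinh x ^ 2)) x := by
    intro x hx
    have hs := sinh_pos_iff.2 hx
    have hc := cosh_pos x
    have h2 : HasDerivAt (fun t => 1 + 1 / cosh t) (-sinh x / cosh x ^ 2) x := by
      simpa using ((hasDerivAt_cosh x).inv hc.ne').const_add 1
    have h1c : (0 : ℝ) < cosh x + 1 := by linarith
    refine HasDerivAt.congr_deriv ((hasDerivAt_arctan_sinh_div_sinh hx).sub (h2.log (hpos x).ne')) ?_
    rw [tanh_eq_sinh_div_cosh]
    have h3 : -sinh x / cosh x ^ 2 / (1 + 1 / cosh x) = (1 - cosh x) / (cosh x * sinh x) := by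
      field_simp
      nlinarith [cosh_sq x]
    rw [h3]
    field_simp
    nlinarith [cosh_sq x]
  have hanti : StrictAntiOn (fun t => arctan (sinh t) / sinh t - log (1 + 1 / cosh t)) (Ioi 0) := by
    apply strictAntiOn_of_deriv_neg (convex_Ioi 0)
    · exact fun x hx => (hd x hx).continuousAt.continuousWithinAt
    · intro x hx
      rw [interior_Ioi] at hx
      rw [(hd x hx).deriv]
      have hs := sinh_pos_iff.2 hx
      have hc := cosh_pos x
      exact mul_neg_of_neg_of_pos (sub_neg.2 (tanh_lt_arctan_sinh hx)) (by positivity)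
  have htop : Tendsto (fun t => arctan (sinh t) / sinh t - log (1 + 1 / cosh t)) atTop (𝓝 0) := by
    have h1 : Tendsto (fun t : ℝ => 1 + 1 / cosh t) atTop (𝓝 (1 + 0)) :=
      (tendsto_const_nhds.div_atTop tendsto_cosh_atTop).const_add 1
    have h2 := h1.log (by norm_num)
    simpa using tendsto_arctan_sinh_div_sinh_atTop.sub h2
  have := pos_of_strictAntiOn_of_tendsto_zero hanti htop ht
  linarith

/-! ### The inequality X < M_q in hyperbolic form -/

theorem strictMonoOn_mul_cosh_div_sinh :
    StrictMonoOn (fun x : ℝ => x * cosh x / sinh x) (Ioi 0) := by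
  have hd : ∀ x : ℝ, 0 < x → HasDerivAt (fun x : ℝ => x * cosh x / sinh x)
      ((sinh x * cosh x - x) / sinh x ^ 2) x := by
    intro x hx
    have hs := (sinh_pos_iff.2 hx).ne'
    refine HasDerivAt.congr_deriv (((hasDerivAt_id x).mul (hasDerivAt_cosh x)).div (hasDerivAt_sinh x) hs) ?_
    congr 1
    simp only [Pi.mul_apply, id]
    linear_combination (-x) * cosh_sq x
  apply strictMonoOn_of_deriv_pos (convex_Ioi 0)
  · exact fun x hx => (hd x hx).continuousAt.continuousWithinAt
  · intro x hx
    rw [interior_Ioi] at hx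
    have hx : 0 < x := hx
    rw [(hd x hx).deriv]
    have h1 := self_lt_sinh_iff.2 hx
    have h2 := one_lt_cosh.2 hx.ne'
    have : 0 < sinh x * cosh x - x := by nlinarith
    positivity

/-- The logarithmic derivative is (αu coth αu - βu coth βu)/u, positive because x coth x increases.
-/
theorem strictMonoOn_sinh_mul_div_sinh_mul {α β : ℝ} (hβ : 0 < β) (h : β < α) :
    StrictMonoOn (fun u : ℝ => sinh (α * u) / sinh (β * u)) (Ioi 0) := by
  have hs : ∀ {c x : ℝ}, 0 < c → 0 < x → 0 < sinh (c * x) := fun hc hx =>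
    sinh_pos_iff.2 (mul_pos hc hx)
  have hds : ∀ c x : ℝ, HasDerivAt (fun x => sinh (c * x)) (cosh (c * x) * c) x := fun c x => by
    simpa using ((hasDerivAt_id x).const_mul c).sinh
  have hd : ∀ x : ℝ, 0 < x → HasDerivAt (fun u : ℝ => sinh (α * u) / sinh (β * u))
      ((cosh (α * x) * α * sinh (β * x) - sinh (α * x) * (cosh (β * x) * β)) / sinh (β * x) ^ 2)
      x := fun x hx => (hds α x).div (hds β x) (hs hβ hx).ne'
  apply strictMonoOn_of_deriv_pos (convex_Ioi 0)
  · exact fun x hx => (hd x hx).continuousAt.continuousWithinAt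
  · intro x hx
    rw [interior_Ioi] at hx
    have hx : 0 < x := hx
    rw [(hd x hx).deriv]
    have hα : 0 < α := hβ.trans h
    have h1 := strictMonoOn_mul_cosh_div_sinh (mul_pos hβ hx) (mul_pos hα hx)
      (mul_lt_mul_of_pos_right h hx)
    simp only at h1
    have hsa := hs hα hx
    have hsb := hs hβ hx
    rw [div_lt_div_iff₀ hsb hsa] at h1
    have : 0 < cosh (α * x) * α * sinh (β * x) - sinh (α * x) * (cosh (β * x) * β) := by
      nlinarith
    positivity

/-- Dividing by sinh(qu) > 0 leaves a constant minus two increasing ratios, since q < 1 - q and q <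
1. -/
theorem crossesDown_sinh_combination {q : ℝ} (h0 : 0 < q) (h1 : q < 1 / 2) :
    CrossesDown (fun u => 3 * sinh (q * u) - sinh ((1 - q) * u) - (1 - 2 * q) * sinh u) := by
  have hanti : StrictAntiOn (fun u : ℝ => 3 - sinh ((1 - q) * u) / sinh (q * u) -
      (1 - 2 * q) * (sinh (1 * u) / sinh (q * u))) (Ioi 0) := by
    intro x hx y hy hxy
    have h2 := strictMonoOn_sinh_mul_div_sinh_mul h0 (show q < 1 - q by linarith) hx hy hxy
    have h3 := strictMonoOn_sinh_mul_div_sinh_mul h0 (show q < 1 by linarith) hx hy hxy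
    have h4 := mul_lt_mul_of_pos_left h3 (show 0 < 1 - 2 * q by linarith)
    simp only at h2 h4 ⊢
    linarith
  have hs : ∀ x, 0 < x → 0 < sinh (q * x) := fun x hx => sinh_pos_iff.2 (by positivity)
  have hc := (CrossesDown.of_strictAntiOn hanti).mul_pos hs
  have heq : ∀ x, 0 < x → sinh (q * x) * (3 - sinh ((1 - q) * x) / sinh (q * x) -
      (1 - 2 * q) * (sinh (1 * x) / sinh (q * x))) =
      3 * sinh (q * x) - sinh ((1 - q) * x) - (1 - 2 * q) * sinh x := fun x hx => by
    have := (hs x hx).ne'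
    rw [one_mul]
    field_simp
  intro x hx hkx y hxy
  have := hc x hx
  simp only [heq x hx] at this
  have := this hkx y hxy
  simpa only [heq y (hx.trans hxy)] using this

/-- Up to a positive factor, the derivative is the previous combination at u = 2t. This function is
in turn the sign-determining factor in the derivative of log M_q - log X. -/
theorem crossesDown_arctan_sinh_combination {q : ℝ} (h0 : 0 < q) (h1 : q < 1 / 2) :
    CrossesDown (fun t => arctan (sinh t) + sinh t ^ 2 * tanh (q * t) / cosh t - sinh t) := by
  have hk : CrossesDown (fun t => 3 * sinh (q * (2 * t)) - sinh ((1 - q) * (2 * t)) -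
      (1 - 2 * q) * sinh (2 * t)) := fun x hx hkx y hxy =>
    crossesDown_sinh_combination h0 h1 (2 * x) (by positivity) hkx (2 * y) (by linarith)
  refine hk.antideriv (p := fun t => sinh t / (4 * cosh t ^ 2 * cosh (q * t) ^ 2)) (l := 0)
    ?_ le_rfl ?_ ?_
  · intro x hx
    have := sinh_pos_iff.2 hx
    have := cosh_pos x
    have := cosh_pos (q * x)
    positivity
  · have hcont : Continuous
        (fun t => arctan (sinh t) + sinh t ^ 2 * tanh (q * t) / cosh t - sinh t) := by
      have h2 : ∀ t : ℝ, cosh t ≠ 0 := fun t => (cosh_pos t).ne'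
      simp only [tanh_eq_sinh_div_cosh]
      fun_prop (disch := intros; apply h2)
    simpa using tendsto_nhdsGT_of_continuous hcont
  · intro t ht
    have hc := cosh_pos t
    have hcq := cosh_pos (q * t)
    have hsq : HasDerivAt (fun t => sinh (q * t)) (cosh (q * t) * q) t := by
      simpa using ((hasDerivAt_id t).const_mul q).sinh
    have hcosq : HasDerivAt (fun t => cosh (q * t)) (sinh (q * t) * q) t := by
      simpa using ((hasDerivAt_id t).const_mul q).cosh
    have h5 := ((hasDerivAt_arctan_sinh t).add ((((hasDerivAt_sinh t).pow 2).mul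
      (hsq.div hcosq hcq.ne')).div (hasDerivAt_cosh t) hc.ne')).sub (hasDerivAt_sinh t)
    simp only [tanh_eq_sinh_div_cosh]
    refine HasDerivAt.congr_deriv h5 ?_
    rw [show (1 - q) * (2 * t) = 2 * t - 2 * (q * t) by ring, sinh_sub,
      show q * (2 * t) = 2 * (q * t) by ring]
    simp only [sinh_two_mul, cosh_two_mul]
    simp
    have e1 := cosh_sq t
    have e2 := cosh_sq (q * t)
    generalize sinh t = s at *
    generalize cosh t = c at *
    generalize sinh (q * t) = a at *
    generalize cosh (q * t) = b at *
    field_simp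
    have e1' : s ^ 2 = c ^ 2 - 1 := by linarith
    have e2' : a ^ 2 = b ^ 2 - 1 := by linarith
    have e3 : s ^ 3 = s * (c ^ 2 - 1) := by rw [← e1']; ring
    ring_nf
    simp only [e1', e2', e3]
    ring

namespace BivariateMean

theorem two_fifths_lt_q : 2 / 5 < q := by
  have h := log_two_gt_d9
  rw [q, div_lt_div_iff₀ (by norm_num) (by linarith)]
  linarith

theorem q_lt : q < 41 / 100 := by
  have h := log_two_gt_d9
  have h' := log_two_lt_d9
  rw [q, div_lt_div_iff₀ (by linarith) (by norm_num)]
  linarith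

theorem q_pos : 0 < q := by linarith [two_fifths_lt_q]

theorem log_two_div_q : log 2 / q = 1 + log 2 := by
  have h := log_two_gt_d9
  have : 0 < 1 + log 2 := by linarith
  rw [q]
  field_simp

end BivariateMean

open BivariateMean

theorem log_cosh_add_arctan_sinh_div_sinh_lt {t : ℝ} (ht : 0 < t) :
    log (cosh t) + arctan (sinh t) / sinh t - 1 < 1 / q * log (cosh (q * t)) := by
  have hq := q_pos
  have hlim : Tendsto (fun t => 1 / q * log (cosh (q * t)) - log (cosh t) -
      arctan (sinh t) / sinh t + 1) (𝓝[>] 0) (𝓝 0) := by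
    have hcont : Continuous (fun t => 1 / q * log (cosh (q * t)) - log (cosh t)) := by
      have : ∀ t : ℝ, cosh t ≠ 0 := fun t => (cosh_pos t).ne'
      fun_prop (disch := intros; apply this)
    have := ((tendsto_nhdsGT_of_continuous hcont).sub tendsto_arctan_sinh_div_sinh).add_const 1
    simpa using this
  have htop : Tendsto (fun t => 1 / q * log (cosh (q * t)) - log (cosh t) -
      arctan (sinh t) / sinh t + 1) atTop (𝓝 0) := by
    have := (((tendsto_log_cosh_mul_sub_self hq).sub tendsto_log_cosh_sub_self).sub
      tendsto_arctan_sinh_div_sinh_atTop).add_const 1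
    -- The defining property of q, log 2 / q = 1 + log 2, is exactly what makes the limit at
    -- infinity vanish.
    rw [log_two_div_q, show -(1 + log 2) - -log 2 - 0 + 1 = 0 by ring] at this
    refine this.congr fun t => ?_
    ring
  have hpos := (crossesDown_arctan_sinh_combination hq
    (show q < 1 / 2 by linarith [q_lt])).pos_of_tendsto_zero
    (p := fun t => cosh t / sinh t ^ 2) (g := fun t => 1 / q * log (cosh (q * t)) - log (cosh t) -
      arctan (sinh t) / sinh t + 1) ?_ le_rfl hlim ?_ htop ht
  · linarith
  · intro x hx
    have := sinh_pos_iff.2 hx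
    have := cosh_pos x
    positivity
  · intro x hx
    have hs := sinh_pos_iff.2 hx
    have hc := cosh_pos x
    have h1 : HasDerivAt (fun t => log (cosh (q * t))) (tanh (q * x) * q) x :=
      HasDerivAt.congr_deriv ((hasDerivAt_log_cosh (q * x)).comp x
        ((hasDerivAt_id x).const_mul q)) (by simp)
    refine HasDerivAt.congr_deriv ((((h1.const_mul (1 / q)).sub (hasDerivAt_log_cosh x)).sub
      (hasDerivAt_arctan_sinh_div_sinh hx)).add_const 1) ?_
    rw [tanh_eq_sinh_div_cosh x]
    field_simp
    linear_combination sinh x * cosh_sq x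

/-! ### The inequality M_q < (L + I)/2 in hyperbolic form -/

/-- Differentiate four times, dropping a factor u the first time. The end of the chain is negative
everywhere because 5q > 2; the values at 0 on the way back are 2 - 4q > 0 and then 0. -/
theorem crossesDown_sinh_cosh_combination {q : ℝ} (h1 : 2 / 5 < q) (h2 : q < 1 / 2) :
    CrossesDown (fun u => 2 * u * sinh u - 2 * (cosh u - 1) - u ^ 2 -
      q * u ^ 2 * (cosh u - 1)) := by
  have hq : 0 < q := by linarith
  have c1 : CrossesDown (fun u => (2 - 5 * q) * sinh u - q * u * cosh u) := by
    intro x hx _ y hxy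
    have hy := hx.trans hxy
    have := mul_pos (show 0 < 5 * q - 2 by linarith) (sinh_pos_iff.2 hy)
    have := mul_pos (mul_pos hq hy) (cosh_pos y)
    simp only
    linarith
  have c2 : CrossesDown (fun u => (2 - 4 * q) * cosh u - q * u * sinh u) := by
    refine c1.antideriv (p := fun _ => 1) (l := 2 - 4 * q) (by simp) (by linarith) ?_ ?_
    · simpa using tendsto_nhdsGT_of_continuous
        (g := fun u => (2 - 4 * q) * cosh u - q * u * sinh u) (by fun_prop)
    · intro x _
      refine HasDerivAt.congr_deriv (((hasDerivAt_cosh x).const_mul (2 - 4 * q)).sub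
        (((hasDerivAt_id x).const_mul q).mul (hasDerivAt_sinh x))) ?_
      simp only [id]
      ring
  have c3 : CrossesDown (fun u => (2 - 3 * q) * sinh u - q * u * cosh u) := by
    refine c2.antideriv (p := fun _ => 1) (l := 0) (by simp) le_rfl ?_ ?_
    · simpa using tendsto_nhdsGT_of_continuous
        (g := fun u => (2 - 3 * q) * sinh u - q * u * cosh u) (by fun_prop)
    · intro x _
      refine HasDerivAt.congr_deriv (((hasDerivAt_sinh x).const_mul (2 - 3 * q)).sub
        (((hasDerivAt_id x).const_mul q).mul (hasDerivAt_cosh x))) ?_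
      simp only [id]
      ring
  have c4 : CrossesDown (fun u => (2 - 2 * q) * (cosh u - 1) - q * u * sinh u) := by
    refine c3.antideriv (p := fun _ => 1) (l := 0) (by simp) le_rfl ?_ ?_
    · simpa using tendsto_nhdsGT_of_continuous
        (g := fun u => (2 - 2 * q) * (cosh u - 1) - q * u * sinh u) (by fun_prop)
    · intro x _
      refine HasDerivAt.congr_deriv ((((hasDerivAt_cosh x).sub_const 1).const_mul (2 - 2 * q)).sub
        (((hasDerivAt_id x).const_mul q).mul (hasDerivAt_sinh x))) ?_
      simp only [id]
      ring
  refine c4.antideriv (p := fun u => u) (l := 0) (by simp) le_rfl ?_ ?_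
  · convert tendsto_nhdsGT_of_continuous
      (g := fun u => 2 * u * sinh u - 2 * (cosh u - 1) - u ^ 2 - q * u ^ 2 * (cosh u - 1))
      (by fun_prop) using 2
    simp
  · intro x _
    refine HasDerivAt.congr_deriv ((((((hasDerivAt_id x).const_mul 2).mul (hasDerivAt_sinh x)).sub
      (((hasDerivAt_cosh x).sub_const 1).const_mul 2)).sub ((hasDerivAt_id x).pow 2)).sub
      ((((hasDerivAt_id x).pow 2).const_mul q).mul ((hasDerivAt_cosh x).sub_const 1))) ?_
    simp [id]
    ring

theorem hasDerivAt_log_sinh_div_self {t : ℝ} (ht : 0 < t) :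
    HasDerivAt (fun t => log (sinh t / t)) (cosh t / sinh t - 1 / t) t := by
  have hs := sinh_pos_iff.2 ht
  refine HasDerivAt.congr_deriv
    (((hasDerivAt_sinh t).div (hasDerivAt_id t) ht.ne').log (div_pos hs ht).ne') ?_
  simp only [Pi.div_apply, id]
  field_simp

theorem hasDerivAt_mul_cosh_div_sinh {t : ℝ} (ht : 0 < t) :
    HasDerivAt (fun t => t * cosh t / sinh t) (cosh t / sinh t - t / sinh t ^ 2) t := by
  have hs := (sinh_pos_iff.2 ht).ne'
  refine HasDerivAt.congr_deriv
    (((hasDerivAt_id t).mul (hasDerivAt_cosh t)).div (hasDerivAt_sinh t) hs) ?_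
  simp only [Pi.mul_apply, id]
  field_simp
  linear_combination (-t) * cosh_sq t

theorem exp_seven_gt : 1096 < exp 7 := by
  have h : exp 7 = exp 1 ^ 7 := by rw [← exp_nat_mul]; norm_num
  rw [h]
  calc (1096 : ℝ) < 2.7182818283 ^ 7 := by norm_num
    _ ≤ _ := by gcongr; exact exp_one_gt_d9.le

theorem exp_seven_quarters_gt : 23 / 4 < exp (7 / 4) := by
  have h : exp (7 / 4) ^ 4 = exp 7 := by rw [← exp_nat_mul]; norm_num
  refine lt_of_pow_lt_pow_left₀ 4 (exp_pos _).le ?_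
  rw [h]
  refine lt_trans ?_ exp_seven_gt
  norm_num

theorem exp_seven_quarters_lt : exp (7 / 4) < 29 / 5 := by
  have h : exp (7 / 4) ^ 4 = exp 1 ^ 7 := by rw [← exp_nat_mul, ← exp_nat_mul]; norm_num
  refine lt_of_pow_lt_pow_left₀ 4 (by norm_num) ?_
  rw [h]
  calc exp 1 ^ 7 ≤ 2.7182818286 ^ 7 := by gcongr; exact exp_one_lt_d9.le
    _ < _ := by norm_num

theorem exp_seven_fifths_gt : 81 / 20 < exp (7 / 5) := by
  have h : exp (7 / 5) ^ 5 = exp 7 := by rw [← exp_nat_mul]; norm_num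
  refine lt_of_pow_lt_pow_left₀ 5 (exp_pos _).le ?_
  rw [h]
  refine lt_trans ?_ exp_seven_gt
  norm_num

theorem log_gt_nine_twentieths : 9 / 20 < log (159 / 100) := by
  rw [lt_log_iff_exp_lt (by norm_num)]
  have h : exp (9 / 20) ^ 20 = exp 1 ^ 9 := by rw [← exp_nat_mul, ← exp_nat_mul]; norm_num
  refine lt_of_pow_lt_pow_left₀ 20 (by norm_num) ?_
  rw [h]
  calc exp 1 ^ 9 ≤ 2.7182818286 ^ 9 := by gcongr; exact exp_one_lt_d9.le
    _ < _ := by norm_num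

/-- A `CrossesDown` function positive at 7/4 is positive on all of (0, 7/4], so one numerical check
settles that range. -/
theorem quadratic_lt_logs_at_seven_quarters {q : ℝ} (hq : q < 41 / 100) :
    0 < (log (sinh (7 / 4) / (7 / 4)) + (7 / 4 * cosh (7 / 4) / sinh (7 / 4) - 1)) / 2 -
      q * (7 / 4) ^ 2 / 2 := by
  have hE := exp_seven_quarters_gt
  have hE' := exp_seven_quarters_lt
  have hinv : exp (-(7 / 4)) < 4 / 23 := by
    rw [exp_neg, inv_lt_comm₀ (exp_pos _) (by norm_num)]
    norm_num
    exact hE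
  have hmul : exp (7 / 4) * exp (-(7 / 4)) = 1 := by rw [← exp_add]; simp
  have hs : sinh (7 / 4) = (exp (7 / 4) - exp (-(7 / 4))) / 2 := sinh_eq _
  have hc : cosh (7 / 4) = (exp (7 / 4) + exp (-(7 / 4))) / 2 := cosh_eq _
  have hs1 : 2787 / 1000 < sinh (7 / 4) := by rw [hs]; linarith
  have hl : log (159 / 100) ≤ log (sinh (7 / 4) / (7 / 4)) :=
    log_le_log (by norm_num) (by rw [le_div_iff₀ (by norm_num)]; linarith)
  have hcoth : 106 / 100 ≤ cosh (7 / 4) / sinh (7 / 4) := by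
    rw [le_div_iff₀ (by linarith), hs, hc]
    nlinarith
  have := log_gt_nine_twentieths
  rw [mul_div_assoc]
  linarith

theorem quadratic_lt_logs {q : ℝ} (h1 : 2 / 5 < q) (h2 : q < 41 / 100) {t : ℝ} (ht : 0 < t)
    (ht' : t ≤ 7 / 4) :
    q * t ^ 2 / 2 < (log (sinh t / t) + (t * cosh t / sinh t - 1)) / 2 := by
  have hk : CrossesDown (fun t => 2 * (2 * t) * sinh (2 * t) - 2 * (cosh (2 * t) - 1) -
      (2 * t) ^ 2 - q * (2 * t) ^ 2 * (cosh (2 * t) - 1)) := fun x hx hkx y hxy =>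
    crossesDown_sinh_cosh_combination h1 (by linarith) (2 * x) (by positivity) hkx (2 * y)
      (by linarith)
  have hJ : CrossesDown (fun t => (log (sinh t / t) + (t * cosh t / sinh t - 1)) / 2 -
      q * t ^ 2 / 2) := by
    refine hk.antideriv (p := fun t => 1 / (8 * t * sinh t ^ 2)) (l := 0) ?_ le_rfl ?_ ?_
    · intro x hx
      have := sinh_pos_iff.2 hx
      positivity
    · have e1 := tendsto_sinh_div_self.log one_ne_zero
      have e2 := tendsto_nhdsGT_of_continuous (g := fun t => q * t ^ 2 / 2) (by fun_prop)
      simpa using ((e1.add (tendsto_mul_cosh_div_sinh.sub_const 1)).div_const 2).sub e2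
    · intro x hx
      have hs := sinh_pos_iff.2 hx
      refine HasDerivAt.congr_deriv ((((hasDerivAt_log_sinh_div_self hx).add
        ((hasDerivAt_mul_cosh_div_sinh hx).sub_const 1)).div_const 2).sub
        ((((hasDerivAt_id x).pow 2).const_mul q).div_const 2)) ?_
      rw [sinh_two_mul, cosh_two_mul, cosh_sq]
      simp
      field_simp
      ring
  by_contra! hcon
  have h7 := quadratic_lt_logs_at_seven_quarters h2
  rcases ht'.lt_or_eq with h | h
  · have := hJ t ht (by simp only; linarith) _ h
    simp only at this
    linarith
  · subst h
    linarith

theorem cosh_rpow_le_exp {p : ℝ} (hp : 0 < p) (t : ℝ) :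
    cosh (p * t) ^ (1 / p) ≤ exp (p * t ^ 2 / 2) := by
  calc cosh (p * t) ^ (1 / p) ≤ exp ((p * t) ^ 2 / 2) ^ (1 / p) :=
        rpow_le_rpow (cosh_pos _).le (cosh_le_exp_half_sq _) (by positivity)
    _ = exp (p * t ^ 2 / 2) := by
        rw [← exp_mul]
        congr 1
        field_simp

theorem exp_half_sum_le (x y : ℝ) : exp ((x + y) / 2) ≤ (exp x + exp y) / 2 := by
  have h1 : exp ((x + y) / 2) = exp (x / 2) * exp (y / 2) := by rw [← exp_add]; ring_nf
  have h2 : exp x = exp (x / 2) ^ 2 := by rw [← exp_nat_mul]; ring_nf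
  have h3 : exp y = exp (y / 2) ^ 2 := by rw [← exp_nat_mul]; ring_nf
  rw [h1, h2, h3]
  nlinarith [sq_nonneg (exp (x / 2) - exp (y / 2))]

theorem cosh_q_rpow_lt_of_le {t : ℝ} (ht : 0 < t) (ht' : t ≤ 7 / 4) :
    cosh (q * t) ^ (1 / q) < (sinh t / t + exp (t * cosh t / sinh t - 1)) / 2 := by
  have h := quadratic_lt_logs two_fifths_lt_q q_lt ht ht'
  have hs := sinh_pos_iff.2 ht
  calc cosh (q * t) ^ (1 / q) ≤ exp (q * t ^ 2 / 2) := cosh_rpow_le_exp q_pos t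
    _ < exp ((log (sinh t / t) + (t * cosh t / sinh t - 1)) / 2) := exp_lt_exp.2 h
    _ ≤ _ := by
      refine (exp_half_sum_le _ _).trans_eq ?_
      rw [exp_log (div_pos hs ht)]

/-- The right side is the cubic Taylor polynomial. Its square agrees with (1 + x)^5 through x^3 and
has larger coefficients beyond. -/
theorem one_add_rpow_five_halves_le {x : ℝ} (hx : 0 ≤ x) :
    (1 + x) ^ (5 / 2 : ℝ) ≤ 1 + 5 / 2 * x + 15 / 8 * x ^ 2 + 5 / 16 * x ^ 3 := by
  refine le_of_sq_le_sq ?_ (by positivity)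
  rw [← rpow_natCast ((1 + x) ^ (5 / 2 : ℝ)), ← rpow_mul (by positivity)]
  norm_num
  have : 0 ≤ x ^ 4 := by positivity
  have : 0 ≤ x ^ 5 := by positivity
  have : 0 ≤ x ^ 6 := by positivity
  nlinarith

theorem cosh_mul_rpow_eq {p : ℝ} (hp : 0 < p) (t : ℝ) :
    cosh (p * t) ^ (1 / p) = exp t * exp (-(log 2 / p)) * (1 + exp (-(2 * (p * t)))) ^ (1 / p) := by
  have h0 : (0 : ℝ) < 1 + exp (-(2 * (p * t))) := by positivity
  have h := log_cosh_sub_self (p * t)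
  rw [log_div h0.ne' two_ne_zero] at h
  rw [rpow_def_of_pos (cosh_pos _), rpow_def_of_pos h0, ← exp_add, ← exp_add]
  congr 1
  generalize log (1 + exp (-(2 * (p * t)))) = w at h ⊢
  field_simp
  linarith

theorem self_mul_exp_neg_le {s : ℝ} (hs : 7 / 5 ≤ s) : s * exp (-s) ≤ 28 / 81 := by
  have h1 : exp s = exp (7 / 5) * exp (s - 7 / 5) := by rw [← exp_add]; ring_nf
  have h2 := add_one_le_exp (s - 7 / 5)
  have h3 := exp_seven_fifths_gt
  have h4 : 81 / 20 * (s - 7 / 5 + 1) ≤ exp s := by rw [h1]; gcongr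
  rw [exp_neg, ← div_eq_mul_inv, div_le_iff₀ (exp_pos s)]
  linarith

theorem cosh_q_rpow_lt_of_ge {t : ℝ} (ht : 7 / 4 ≤ t) :
    cosh (q * t) ^ (1 / q) < (sinh t / t + exp (t * cosh t / sinh t - 1)) / 2 := by
  have ht0 : 0 < t := by linarith
  have hq := two_fifths_lt_q
  have hq0 := q_pos
  have hs := sinh_pos_iff.2 ht0
  -- Since q > 2/5, `x` dominates e^(-2qt) and 5/2 dominates 1/q. With s = 4t/5 ≥ 7/5, the bound on
  -- s e^(-s) controls `t * x`.
  set x := exp (-(4 / 5 * t)) with hx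
  have hx0 : 0 < x := exp_pos _
  have hsx : 4 / 5 * t * x ≤ 28 / 81 := self_mul_exp_neg_le (by linarith)
  have hx1 : x ≤ 20 / 81 := by nlinarith
  have hpow : (1 + exp (-(2 * (q * t)))) ^ (1 / q) ≤
      1 + 5 / 2 * x + 15 / 8 * x ^ 2 + 5 / 16 * x ^ 3 := by
    refine le_trans ?_ (one_add_rpow_five_halves_le hx0.le)
    have hexp : exp (-(2 * (q * t))) ≤ x := exp_le_exp.2 (by nlinarith)
    calc (1 + exp (-(2 * (q * t)))) ^ (1 / q) ≤ (1 + x) ^ (1 / q) := by gcongr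
      _ ≤ (1 + x) ^ (5 / 2 : ℝ) := by
        apply rpow_le_rpow_of_exponent_le (by linarith)
        rw [div_le_div_iff₀ hq0 two_pos]
        linarith
  have hI : exp (t - 1) ≤ exp (t * cosh t / sinh t - 1) := by
    apply exp_le_exp.2
    have : t ≤ t * cosh t / sinh t := by
      rw [le_div_iff₀ hs]
      exact mul_le_mul_of_nonneg_left (sinh_lt_cosh t).le ht0.le
    linarith
  have hy : exp (-(2 * t)) ≤ 31 / 1000 := by
    have h1 : exp (-(2 * t)) ≤ exp (-(7 / 4)) ^ 2 := by
      rw [← exp_nat_mul]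
      exact exp_le_exp.2 (by push_cast; linarith)
    have hinv : exp (-(7 / 4)) < 4 / 23 := by
      rw [exp_neg, inv_lt_comm₀ (exp_pos _) (by norm_num)]
      norm_num
      exact exp_seven_quarters_gt
    nlinarith [exp_pos (-(7 / 4))]
  have hL : sinh t / t = exp t * ((1 - exp (-(2 * t))) / (2 * t)) := by
    have h1 : exp (-t) = exp t * exp (-(2 * t)) := by rw [← exp_add]; ring_nf
    rw [sinh_eq, h1]
    field_simp
  have hconst : exp (-(log 2 / q)) = exp (-1) / 2 := by
    rw [log_two_div_q, neg_add, exp_add, exp_neg (log 2), exp_log two_pos, div_eq_mul_inv]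
  have he : exp 1 * exp (-1) = 1 := by rw [← exp_add]; simp
  have hsub : exp (t - 1) = exp t * exp (-1) := by rw [← exp_add]; ring_nf
  -- After division by e^(t-1)/2, the leading 1 of the power mean is matched by I; what remains must
  -- be beaten by L.
  have hkey : 5 / 2 * x + 15 / 8 * x ^ 2 + 5 / 16 * x ^ 3 <
      exp 1 * ((1 - exp (-(2 * t))) / (2 * t)) := by
    rw [← mul_div_assoc, lt_div_iff₀ (by positivity)]
    have h1 : 2.634 ≤ exp 1 * (1 - exp (-(2 * t))) := by
      have := exp_one_gt_d9
      calc (2.634 : ℝ) ≤ 2.7182818283 * (1 - 31 / 1000) := by norm_num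
        _ ≤ _ := by gcongr
    refine lt_of_lt_of_le ?_ h1
    have h2 : 5 / 2 + 15 / 8 * x + 5 / 16 * x ^ 2 ≤
        5 / 2 + 15 / 8 * (20 / 81) + 5 / 16 * (20 / 81) ^ 2 := by gcongr
    calc (5 / 2 * x + 15 / 8 * x ^ 2 + 5 / 16 * x ^ 3) * (2 * t)
        = 5 / 2 * (4 / 5 * t * x) * (5 / 2 + 15 / 8 * x + 5 / 16 * x ^ 2) := by ring
      _ ≤ 5 / 2 * (28 / 81) * (5 / 2 + 15 / 8 * (20 / 81) + 5 / 16 * (20 / 81) ^ 2) := by gcongr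
      _ < 2.634 := by norm_num
  rw [cosh_mul_rpow_eq hq0, hconst]
  calc exp t * (exp (-1) / 2) * (1 + exp (-(2 * (q * t)))) ^ (1 / q)
      ≤ exp t * (exp (-1) / 2) * (1 + 5 / 2 * x + 15 / 8 * x ^ 2 + 5 / 16 * x ^ 3) := by gcongr
    _ < exp t * (exp (-1) / 2) * (1 + exp 1 * ((1 - exp (-(2 * t))) / (2 * t))) := by
        refine mul_lt_mul_of_pos_left ?_ (by positivity)
        linarith
    _ = (sinh t / t + exp (t - 1)) / 2 := by
        rw [hL, hsub]
        linear_combination (exp t * ((1 - exp (-(2 * t))) / (2 * t)) / 2) * he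
    _ ≤ _ := by linarith

theorem cosh_q_rpow_lt {t : ℝ} (ht : 0 < t) :
    cosh (q * t) ^ (1 / q) < (sinh t / t + exp (t * cosh t / sinh t - 1)) / 2 := by
  rcases le_total t (7 / 4) with h | h
  · exact cosh_q_rpow_lt_of_le ht h
  · exact cosh_q_rpow_lt_of_ge h

/-! ### The inequality L + I < A + G in hyperbolic form -/

theorem factorial_quadratic_mul_four_pow_le (n : ℕ) :
    4 * ((2 * n + 9) * (2 * n + 8)) * (4 : ℝ) ^ (n + 3) ≤ 27 * 9 ^ (n + 3) := by
  induction n with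
  | zero => norm_num
  | succ n ih =>
    have h4 : (0 : ℝ) < 4 ^ (n + 3) := by positivity
    have e4 : (4 : ℝ) ^ (n + 1 + 3) = 4 * 4 ^ (n + 3) := by ring
    have e9 : (9 : ℝ) ^ (n + 1 + 3) = 9 * 9 ^ (n + 3) := by ring
    rw [e4, e9]
    push_cast
    have h : 4 * ((2 * ((n : ℝ) + 1) + 9) * (2 * (n + 1) + 8)) ≤
        9 * ((2 * n + 9) * (2 * n + 8)) := by nlinarith [n.cast_nonneg (α := ℝ)]
    nlinarith [mul_le_mul_of_nonneg_right h h4.le]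

/-- The value is 0 for n = 1 and n = 2; from n = 3 on, 9^n outweighs n² 4^n. -/
theorem sinh_cubed_coeff_nonneg {n : ℕ} (hn : n ≠ 0) :
    0 ≤ ((3 : ℝ) ^ (2 * n + 3) - 3) / 4 - (2 * n + 3) * (2 * n + 2) * (2 + 2 ^ (2 * n)) +
      (2 * n + 3) * (2 * n + 2) * (2 * n + 1) := by
  obtain rfl | rfl | ⟨k, rfl⟩ : n = 1 ∨ n = 2 ∨ ∃ k, n = k + 3 := by
    rcases n with _ | _ | _ | k <;> simp_all
  · norm_num
  · norm_num
  · have h := factorial_quadratic_mul_four_pow_le k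
    have e9 : (3 : ℝ) ^ (2 * (k + 3) + 3) = 27 * 9 ^ (k + 3) := by
      rw [pow_add, pow_mul]; norm_num; ring
    rw [e9, pow_mul]
    push_cast
    norm_num
    have hk : (0 : ℝ) ≤ k := k.cast_nonneg
    have h' : 3 / 4 ≤ (2 * (k : ℝ) + 9) * (2 * k + 8) * (2 * k + 5) := by
      calc (3 / 4 : ℝ) ≤ 9 * 8 * 5 := by norm_num
        _ ≤ _ := by gcongr <;> linarith
    linarith

open Nat in
-- Expand with sinh³ t = (sinh 3t - 3 sinh t)/4 and sinh t cosh t = sinh(2t)/2. The coefficients are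
-- nonnegative, and that of t^9 is positive.
theorem sinh_cubed_combination_pos {t : ℝ} (ht : 0 < t) :
    0 < sinh t ^ 3 - 2 * t ^ 2 * sinh t - t ^ 2 * sinh t * cosh t + t ^ 3 * cosh t + t ^ 3 := by
  have hsinh : ∀ x : ℝ,
      HasSum (fun n : ℕ => x ^ (2 * (n + 1) + 1) / ((2 * (n + 1) + 1)! : ℝ)) (sinh x - x) := by
    intro x
    have := (hasSum_nat_add_iff' 1).2 (hasSum_sinh x)
    simpa using this
  -- Dropping the linear terms aligns every series at t^(2n+3). The isolated t³ enters at n = 0,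
  -- where it cancels the -t³ of the others.
  have hsum := ((((((hsinh (3 * t)).sub ((hsinh t).mul_left 3)).div_const 4).sub
    ((hasSum_sinh t).mul_left (2 * t ^ 2))).sub ((hasSum_sinh (2 * t)).mul_left (t ^ 2 / 2))).add
    ((hasSum_cosh t).mul_left (t ^ 3))).add (hasSum_ite_eq 0 (t ^ 3))
  have hterm : ∀ n : ℕ, n ≠ 0 → (((3 * t) ^ (2 * (n + 1) + 1) / ((2 * (n + 1) + 1)! : ℝ) -
      3 * (t ^ (2 * (n + 1) + 1) / ((2 * (n + 1) + 1)! : ℝ))) / 4 -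
      2 * t ^ 2 * (t ^ (2 * n + 1) / ((2 * n + 1)! : ℝ)) -
      t ^ 2 / 2 * ((2 * t) ^ (2 * n + 1) / ((2 * n + 1)! : ℝ)) +
      t ^ 3 * (t ^ (2 * n) / ((2 * n)! : ℝ)) + if n = 0 then t ^ 3 else 0) =
      t ^ (2 * n + 3) / ((2 * n + 3)! : ℝ) * (((3 : ℝ) ^ (2 * n + 3) - 3) / 4 -
        (2 * n + 3) * (2 * n + 2) * (2 + 2 ^ (2 * n)) +
        (2 * n + 3) * (2 * n + 2) * (2 * n + 1)) := by
    intro n hn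
    have e1 : ((2 * n + 1)! : ℝ) = (2 * n + 1) * ((2 * n)! : ℝ) := by
      rw [factorial_succ]; push_cast; ring
    have e3 : ((2 * n + 3)! : ℝ) = (2 * n + 3) * (2 * n + 2) * ((2 * n + 1) * ((2 * n)! : ℝ)) := by
      rw [← e1, factorial_succ, factorial_succ (2 * n + 1)]; push_cast; ring
    have h0 : ((2 * n)! : ℝ) ≠ 0 := by positivity
    rw [if_neg hn, show 2 * (n + 1) + 1 = 2 * n + 3 by ring, e3, e1, mul_pow, mul_pow]
    field_simp
    ring
  have hnonneg : ∀ n : ℕ, n ≠ 0 → 0 ≤ t ^ (2 * n + 3) / ((2 * n + 3)! : ℝ) *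
      (((3 : ℝ) ^ (2 * n + 3) - 3) / 4 - (2 * n + 3) * (2 * n + 2) * (2 + 2 ^ (2 * n)) +
        (2 * n + 3) * (2 * n + 2) * (2 * n + 1)) := fun n hn =>
    mul_nonneg (by positivity) (sinh_cubed_coeff_nonneg hn)
  have hle := le_hasSum hsum 3 (fun n _ => by
    rcases eq_or_ne n 0 with rfl | hn
    · simp [factorial]
      ring_nf
      exact le_rfl
    · rw [hterm n hn]
      exact hnonneg n hn)
  rw [hterm 3 (by norm_num)] at hle
  have h3 : 0 < t ^ (2 * 3 + 3) / ((2 * 3 + 3)! : ℝ) *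
      (((3 : ℝ) ^ (2 * 3 + 3) - 3) / 4 - (2 * (3 : ℕ) + 3) * (2 * (3 : ℕ) + 2) * (2 + 2 ^ (2 * 3)) +
        (2 * (3 : ℕ) + 3) * (2 * (3 : ℕ) + 2) * (2 * (3 : ℕ) + 1)) :=
    _root_.mul_pos (by positivity) (by norm_num)
  refine (h3.trans_le hle).trans_eq ?_
  rw [sinh_three_mul, sinh_two_mul]
  ring

/-- Isolate the exponential and take logarithms. The difference starts from 0, and its derivative
has the preceding combination as numerator. -/
theorem sinh_div_self_add_exp_lt {t : ℝ} (ht : 0 < t) :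
    sinh t / t + exp (t * cosh t / sinh t - 1) < cosh t + 1 := by
  have hpos : ∀ x : ℝ, 0 < x → 0 < x * (cosh x + 1) - sinh x := by
    intro x hx
    refine pos_of_hasDerivAt_pos (l := 0) (g := fun x => x * (cosh x + 1) - sinh x)
      (g' := fun x => 1 + x * sinh x) hx le_rfl ?_ ?_ ?_
    · convert tendsto_nhdsGT_of_continuous (g := fun x => x * (cosh x + 1) - sinh x)
        (by fun_prop) using 2
      simp
    · intro y _
      refine HasDerivAt.congr_deriv (((hasDerivAt_id y).mul
        ((hasDerivAt_cosh y).add_const 1)).sub (hasDerivAt_sinh y)) ?_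
      simp only [id]
      ring
    · intro y hy _
      have := mul_pos hy (sinh_pos_iff.2 hy)
      linarith
  have hpos' : ∀ x : ℝ, 0 < x → 0 < cosh x + 1 - sinh x / x := by
    intro x hx
    have h := div_pos (hpos x hx) hx
    rwa [sub_div, mul_div_cancel_left₀ _ hx.ne'] at h
  have key : 0 < log (cosh t + 1 - sinh t / t) - (t * cosh t / sinh t - 1) := by
    refine pos_of_hasDerivAt_pos (l := 0)
      (g := fun t => log (cosh t + 1 - sinh t / t) - (t * cosh t / sinh t - 1))
      (g' := fun t => (sinh t ^ 3 - 2 * t ^ 2 * sinh t - t ^ 2 * sinh t * cosh t + t ^ 3 * cosh t +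
        t ^ 3) / (t * sinh t ^ 2 * (t * (cosh t + 1) - sinh t))) ht le_rfl ?_ ?_ ?_
    · have h1 := (tendsto_nhdsGT_of_continuous (g := fun t => cosh t + 1) (by fun_prop)).sub
        tendsto_sinh_div_self
      have h2 := h1.log (by simp)
      have h3 := h2.sub (tendsto_mul_cosh_div_sinh.sub_const 1)
      simpa using h3
    · intro y hy
      have hs := sinh_pos_iff.2 hy
      have hd := hpos y hy
      have heq : cosh y + 1 - sinh y / y = (y * (cosh y + 1) - sinh y) / y := by field_simp
      refine HasDerivAt.congr_deriv (((((hasDerivAt_cosh y).add_const 1).sub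
        ((hasDerivAt_sinh y).div (hasDerivAt_id y) hy.ne')).log (hpos' y hy).ne').sub
        ((hasDerivAt_mul_cosh_div_sinh hy).sub_const 1)) ?_
      simp only [Pi.sub_apply, Pi.div_apply, id]
      rw [heq]
      have e1 := cosh_sq y
      generalize sinh y = s at *
      generalize cosh y = c at *
      field_simp
      have e2 : c ^ 2 = s ^ 2 + 1 := e1
      ring_nf
      simp only [e2]
      ring
    · intro y hy _
      have := sinh_cubed_combination_pos hy
      have := hpos y hy
      have := sinh_pos_iff.2 hy
      positivity
  have h := (lt_log_iff_exp_lt (hpos' t ht)).1 (sub_pos.1 key)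
  linarith

/-! ### The means in exponential coordinates -/

namespace BivariateMean

theorem A_comm (a b : ℝ) : A a b = A b a := by rw [A, A, add_comm]

theorem G_comm (a b : ℝ) : G a b = G b a := by rw [G, G, mul_comm]

theorem P_comm (a b : ℝ) : P a b = P b a := by
  rw [P, P, ← neg_sub b a, add_comm b a, neg_div (a + b), arcsin_neg, mul_neg, neg_div_neg_eq]

theorem X_comm (a b : ℝ) : X a b = X b a := by rw [X, X, A_comm, G_comm, P_comm]

theorem L_comm (a b : ℝ) : L a b = L b a := by
  rw [L, L, ← neg_sub b a, ← neg_sub (log b), neg_div_neg_eq]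

theorem I_comm {a b : ℝ} (ha : 0 < a) (hb : 0 < b) : I a b = I b a := by
  rw [I, I, ← inv_div (b ^ b) (a ^ a), ← neg_sub b a, one_div_neg_eq_neg_one_div, rpow_neg (by positivity),
    inv_rpow (by positivity), inv_inv]

theorem M_comm (p a b : ℝ) : M p a b = M p b a := by rw [M, M, mul_comm a b, add_comm]

theorem A_exp (m t : ℝ) : A (m * exp t) (m * exp (-t)) = m * cosh t := by
  rw [A, cosh_eq]; ring

theorem exp_mul_exp_neg (t : ℝ) : exp t * exp (-t) = 1 := by rw [← exp_add]; simp

theorem G_exp {m : ℝ} (hm : 0 < m) (t : ℝ) : G (m * exp t) (m * exp (-t)) = m := by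
  rw [G, show m * exp t * (m * exp (-t)) = m ^ 2 * (exp t * exp (-t)) by ring, exp_mul_exp_neg,
    mul_one, sqrt_sq hm.le]

theorem sub_exp (m t : ℝ) : m * exp t - m * exp (-t) = 2 * (m * sinh t) := by
  rw [sinh_eq]; ring

theorem P_exp {m : ℝ} (hm : 0 < m) (t : ℝ) :
    P (m * exp t) (m * exp (-t)) = m * sinh t / arctan (sinh t) := by
  have h1 : m * exp t + m * exp (-t) = 2 * (m * cosh t) := by rw [cosh_eq]; ring
  have hc := cosh_pos t
  have h2 : 2 * (m * sinh t) / (2 * (m * cosh t)) = sinh t / √(1 + sinh t ^ 2) := by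
    rw [add_comm, ← cosh_sq, sqrt_sq hc.le]
    field_simp
  rw [P, h1, sub_exp, h2, ← arctan_eq_arcsin, mul_div_mul_left _ _ two_ne_zero]

theorem X_exp {m : ℝ} (hm : 0 < m) (t : ℝ) :
    X (m * exp t) (m * exp (-t)) = m * (cosh t * exp (arctan (sinh t) / sinh t - 1)) := by
  rw [X, A_exp, G_exp hm, P_exp hm, ← mul_assoc, div_div_eq_mul_div, mul_div_mul_left _ _ hm.ne']

theorem L_exp {m : ℝ} (hm : 0 < m) (t : ℝ) :
    L (m * exp t) (m * exp (-t)) = m * (sinh t / t) := by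
  rw [L, sub_exp, log_mul hm.ne' (exp_pos _).ne', log_mul hm.ne' (exp_pos _).ne', log_exp, log_exp,
    show log m + t - (log m + -t) = 2 * t by ring, mul_div_mul_left _ _ two_ne_zero, mul_div_assoc]

theorem I_exp {m : ℝ} (hm : 0 < m) {t : ℝ} (ht : 0 < t) :
    I (m * exp t) (m * exp (-t)) = m * exp (t * cosh t / sinh t - 1) := by
  have hs := sinh_pos_iff.2 ht
  have h1 : 0 < m * exp t := by positivity
  have h2 : 0 < m * exp (-t) := by positivity
  have h3 : log (m * exp t) = log m + t := by rw [log_mul hm.ne' (exp_pos _).ne', log_exp]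
  have h4 : log (m * exp (-t)) = log m + -t := by rw [log_mul hm.ne' (exp_pos _).ne', log_exp]
  rw [I, rpow_def_of_pos h1, rpow_def_of_pos h2, ← exp_sub, ← exp_mul, one_div, ← exp_neg,
    ← exp_add, sub_exp, h3, h4]
  have h6 : m * exp (t * cosh t / sinh t - 1) = exp (log m + (t * cosh t / sinh t - 1)) := by
    rw [exp_add, exp_log hm]
  rw [h6]
  congr 1
  have h5 : (log m + t) * (m * exp t) - (log m + -t) * (m * exp (-t)) =
      2 * (m * (log m * sinh t + t * cosh t)) := by
    rw [sinh_eq, cosh_eq]; ring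
  rw [h5]
  field_simp
  ring

theorem M_exp {m : ℝ} (hm : 0 < m) {p : ℝ} (hp : p ≠ 0) (t : ℝ) :
    M p (m * exp t) (m * exp (-t)) = m * cosh (p * t) ^ (1 / p) := by
  rw [M, if_neg hp, mul_rpow hm.le (exp_pos _).le, mul_rpow hm.le (exp_pos _).le, ← exp_mul,
    ← exp_mul]
  have h : (m ^ p * exp (t * p) + m ^ p * exp (-t * p)) / 2 = m ^ p * cosh (p * t) := by
    rw [cosh_eq]; ring_nf
  rw [h, mul_rpow (by positivity) (cosh_pos _).le, ← rpow_mul hm.le, mul_one_div_cancel hp,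
    rpow_one]

theorem exists_eq_mul_exp {a b : ℝ} (hb : 0 < b) (hab : b < a) :
    ∃ m t : ℝ, 0 < m ∧ 0 < t ∧ a = m * exp t ∧ b = m * exp (-t) := by
  have ha : 0 < a := hb.trans hab
  -- Here m is the geometric mean and t half the logarithm of a/b.
  refine ⟨exp ((log a + log b) / 2), (log a - log b) / 2, exp_pos _, ?_, ?_, ?_⟩
  · linarith [log_lt_log hb hab]
  · rw [← exp_add]; ring_nf; rw [exp_log ha]
  · rw [← exp_add]; ring_nf; rw [exp_log hb]

theorem A_add_G_div_exp_one_lt_X {m t : ℝ} (hm : 0 < m) (ht : 0 < t) :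
    (A (m * exp t) (m * exp (-t)) + G (m * exp t) (m * exp (-t))) / exp 1 <
      X (m * exp t) (m * exp (-t)) := by
  have hc := cosh_pos t
  have h := (log_lt_iff_lt_exp (by positivity)).1 (log_one_add_inv_cosh_lt ht)
  rw [A_exp, G_exp hm, X_exp hm, exp_sub, div_eq_mul_inv, ← mul_div_assoc, ← mul_div_assoc,
    ← div_eq_mul_inv]
  gcongr
  calc m * cosh t + m = m * (cosh t * (1 + 1 / cosh t)) := by field_simp
    _ < _ := by gcongr

theorem X_lt_M_q {m t : ℝ} (hm : 0 < m) (ht : 0 < t) :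
    X (m * exp t) (m * exp (-t)) < M q (m * exp t) (m * exp (-t)) := by
  rw [X_exp hm, M_exp hm q_pos.ne', rpow_def_of_pos (cosh_pos _)]
  nth_rewrite 1 [← exp_log (cosh_pos t)]
  rw [← exp_add]
  gcongr
  linarith [log_cosh_add_arctan_sinh_div_sinh_lt ht]

theorem M_q_lt {m t : ℝ} (hm : 0 < m) (ht : 0 < t) :
    M q (m * exp t) (m * exp (-t)) <
      (L (m * exp t) (m * exp (-t)) + I (m * exp t) (m * exp (-t))) / 2 := by
  rw [M_exp hm q_pos.ne', L_exp hm, I_exp hm ht, ← mul_add, mul_div_assoc]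
  exact mul_lt_mul_of_pos_left (cosh_q_rpow_lt ht) hm

theorem L_add_I_lt_A_add_G {m t : ℝ} (hm : 0 < m) (ht : 0 < t) :
    (L (m * exp t) (m * exp (-t)) + I (m * exp t) (m * exp (-t))) / 2 <
      (A (m * exp t) (m * exp (-t)) + G (m * exp t) (m * exp (-t))) / 2 := by
  have h := mul_lt_mul_of_pos_left (sinh_div_self_add_exp_lt ht) hm
  rw [L_exp hm, I_exp hm ht, A_exp, G_exp hm]
  linarith

theorem mean_chain {a b : ℝ} (ha : 0 < a) (hb : 0 < b) (hab : a ≠ b) :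
    (A a b + G a b) / exp 1 < X a b ∧ X a b < M q a b ∧ M q a b < (L a b + I a b) / 2 ∧
      (L a b + I a b) / 2 < (A a b + G a b) / 2 := by
  wlog h : b < a generalizing a b
  · rw [A_comm, G_comm, X_comm, M_comm, L_comm, I_comm ha hb]
    exact this hb ha hab.symm (lt_of_le_of_ne (not_lt.1 h) hab)
  obtain ⟨m, t, hm, ht, rfl, rfl⟩ := exists_eq_mul_exp hb h
  exact ⟨A_add_G_div_exp_one_lt_X hm ht, X_lt_M_q hm ht, M_q_lt hm ht, L_add_I_lt_A_add_G hm ht⟩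

/-! ### Optimality of q -/

theorem exp_ne_exp_neg {t : ℝ} (ht : 0 < t) : 1 * exp t ≠ 1 * exp (-t) := by
  intro h
  rw [one_mul, one_mul, exp_eq_exp] at h
  linarith

theorem M_le_one_of_nonpos {p : ℝ} (hp : p ≤ 0) (t : ℝ) : M p (1 * exp t) (1 * exp (-t)) ≤ 1 := by
  rcases hp.eq_or_lt with rfl | hp
  · rw [M, if_pos rfl, one_mul, one_mul, exp_mul_exp_neg, sqrt_one]
  · rw [M_exp one_pos hp.ne, one_mul]
    exact rpow_le_one_of_one_le_of_nonpos (one_le_cosh _) (one_div_nonpos.2 hp.le)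

theorem q_le_of_X_lt_M {p : ℝ} (h : ∀ a b : ℝ, 0 < a → 0 < b → a ≠ b → X a b < M p a b) :
    q ≤ p := by
  have hX : ∀ t : ℝ, 0 < t → X (1 * exp t) (1 * exp (-t)) < M p (1 * exp t) (1 * exp (-t)) :=
    fun t ht => h _ _ (by positivity) (by positivity) (exp_ne_exp_neg ht)
  have hp : 0 < p := by
    -- For p ≤ 0, M_p stays below G = 1, whereas X > (A + G)/e is unbounded.
    by_contra! hp
    obtain ⟨t, hge, ht⟩ := ((tendsto_cosh_atTop.eventually_ge_atTop (exp 1)).and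
      (eventually_gt_atTop 0)).exists
    have h1 := A_add_G_div_exp_one_lt_X one_pos ht
    have h2 := (hX t ht).trans_le (M_le_one_of_nonpos hp t)
    rw [A_exp, G_exp one_pos] at h1
    have h3 := h1.trans h2
    rw [div_lt_one (exp_pos 1)] at h3
    linarith
  have hle : ∀ t : ℝ, 0 < t → log (cosh t) - t + arctan (sinh t) / sinh t - 1 ≤
      1 / p * log (cosh (p * t)) - t := by
    intro t ht
    have h1 := hX t ht
    rw [X_exp one_pos, M_exp one_pos hp.ne', one_mul, one_mul, rpow_def_of_pos (cosh_pos _)] at h1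
    have h2 := log_lt_log (by have := cosh_pos t; positivity) h1
    rw [log_mul (cosh_pos t).ne' (exp_pos _).ne', log_exp, log_exp] at h2
    linarith
  -- Letting t → ∞ in the logarithmic comparison gives log 2 / p ≤ 1 + log 2 = log 2 / q.
  have hlim : -log 2 + 0 - 1 ≤ -(log 2 / p) :=
    le_of_tendsto_of_tendsto
      ((tendsto_log_cosh_sub_self.add tendsto_arctan_sinh_div_sinh_atTop).sub_const 1)
      (tendsto_log_cosh_mul_sub_self hp)
      ((eventually_gt_atTop 0).mono hle)
  have hdiv : log 2 / p ≤ log 2 / q := by rw [log_two_div_q]; linarith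
  exact (div_le_div_iff_of_pos_left (log_pos one_lt_two) hp q_pos).1 hdiv

/-- The L part decays like 1/(2t), and t coth t - t = (t / sinh t) e^(-t) tends to 0, so only I
contributes to the limit. -/
theorem tendsto_exp_neg_mul_logarithmic_add_identric :
    Tendsto (fun t : ℝ => exp (-t) * ((sinh t / t + exp (t * cosh t / sinh t - 1)) / 2)) atTop
      (𝓝 (exp (-1) / 2)) := by
  have h1 : Tendsto (fun t : ℝ => (1 - exp (-(2 * t))) / 2 / t) atTop (𝓝 0) :=
    ((tendsto_exp_neg_two_mul.const_sub 1).div_const 2).div_atTop tendsto_id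
  have h2 : Tendsto (fun t : ℝ => t / sinh t * exp (-t)) atTop (𝓝 0) := by
    refine squeeze_zero' ?_ ?_ (tendsto_exp_neg_atTop_nhds_zero)
    · filter_upwards [eventually_gt_atTop 0] with t ht
      have := sinh_pos_iff.2 ht
      positivity
    · filter_upwards [eventually_gt_atTop 0] with t ht
      refine mul_le_of_le_one_left (exp_pos _).le ?_
      exact (div_le_one (sinh_pos_iff.2 ht)).2 (self_le_sinh_iff.2 ht.le)
  have h3 := (h1.add ((continuous_exp.tendsto _).comp (h2.sub_const 1))).div_const 2
  rw [zero_add, zero_sub] at h3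
  refine h3.congr' ?_
  filter_upwards [eventually_gt_atTop 0] with t ht
  have hs := (sinh_pos_iff.2 ht).ne'
  have e1 : t / sinh t * exp (-t) - 1 = -t + (t * cosh t / sinh t - 1) := by
    rw [← cosh_sub_sinh]
    field_simp
    ring
  have e2 : (1 - exp (-(2 * t))) / 2 = exp (-t) * sinh t := by
    rw [sinh_eq, show -(2 * t) = -t + -t by ring, exp_add]
    linear_combination (-1 / 2 : ℝ) * exp_mul_exp_neg t
  rw [Function.comp_apply, e1, exp_add, e2]
  ring

theorem le_q_of_M_lt {p : ℝ}
    (h : ∀ a b : ℝ, 0 < a → 0 < b → a ≠ b → M p a b < (L a b + I a b) / 2) : p ≤ q := by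
  rcases le_or_gt p 0 with hp0 | hp
  · exact hp0.trans q_pos.le
  have hle : ∀ t : ℝ, 0 < t → exp (1 / p * log (cosh (p * t)) - t) ≤
      exp (-t) * ((sinh t / t + exp (t * cosh t / sinh t - 1)) / 2) := by
    intro t ht
    have h1 := h (1 * exp t) (1 * exp (-t)) (by positivity) (by positivity) (exp_ne_exp_neg ht)
    rw [M_exp one_pos hp.ne', L_exp one_pos, I_exp one_pos ht, one_mul, one_mul, one_mul,
      rpow_def_of_pos (cosh_pos _)] at h1
    rw [sub_eq_neg_add, exp_add, mul_comm (1 / p)]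
    exact mul_le_mul_of_nonneg_left h1.le (exp_pos _).le
  have hlim : exp (-(log 2 / p)) ≤ exp (-1) / 2 :=
    le_of_tendsto_of_tendsto
      ((continuous_exp.tendsto _).comp (tendsto_log_cosh_mul_sub_self hp))
      tendsto_exp_neg_mul_logarithmic_add_identric ((eventually_gt_atTop 0).mono hle)
  have hq : exp (-1) / 2 = exp (-(log 2 / q)) := by
    rw [log_two_div_q, neg_add, exp_add, exp_neg (log 2), exp_log two_pos, div_eq_mul_inv]
  rw [hq, exp_le_exp, neg_le_neg_iff] at hlim
  exact (div_le_div_iff_of_pos_left (log_pos one_lt_two) q_pos hp).1 hlim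

end BivariateMean

end

open BivariateMean in
theorem theorem2p2 :
    (∀ a b : ℝ, 0 < a → 0 < b → a ≠ b →
      (A a b + G a b) / Real.exp 1 < X a b ∧
      X a b < M q a b ∧
      M q a b < (L a b + I a b) / 2 ∧
      (L a b + I a b) / 2 < (A a b + G a b) / 2) ∧
    IsLeast {p : ℝ | ∀ a b : ℝ, 0 < a → 0 < b → a ≠ b → X a b < M p a b} q ∧
    IsGreatest {p : ℝ | ∀ a b : ℝ, 0 < a → 0 < b → a ≠ b →
      M p a b < (L a b + I a b) / 2} q :=
  ⟨fun _ _ => mean_chain,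
    ⟨fun _ _ ha hb hab => (mean_chain ha hb hab).2.1, fun _ => q_le_of_X_lt_M⟩,
    ⟨fun _ _ ha hb hab => (mean_chain ha hb hab).2.2.1, fun _ => le_q_of_M_lt⟩⟩
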